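/- Let $\mathcal H$ be a separable real Hilbert space, let $\Sigma:\mathcal H\to\mathcal H$ be a bounded, self-adjoint, positive, injective, trace-class operator, let $\sigma>0$ and let $\varepsilon\sim\mathcal N(0,\sigma^2\Sigma)$ be a centered Gaussian random element of $\mathcal H$. Let $\mathcal H_\Sigma=\operatorname{Range}(\Sigma^{1/2})$ be the Cameron--Martin space, with norm $\|h\|_{\mathcal H_\Sigma}=\|\Sigma^{-1/2}h\|_{\mathcal H}$, and for $M>0$ let $K_M$ be the closure in $\mathcal H$ of $\{\mu\in\mathcal H_\Sigma:\|\mu\|_{\mathcal H_\Sigma}\le M\}$. Let $S\subset\mathcal H$ be a Borel set and $f:S\to\mathbb R$ a Borel function; for $N>0$ put $g_N(x)=e^{Nf(x)}\mathbf 1_{\{x\in S\}}$ and $F_N(\mu)=\mathbb E[g_N(\mu+\varepsilon)]$ for $\mu\in\mathcal H$. Assume that $g_N$ is bounded for each $N>0$, and that $f$ has a unique optimizer $\xi^\star\in\operatorname{int}(S)$ in the well-separated sense: $f(x)<f(\xi^\star)$ for all $x\in S\setminus\{\xi^\star\}$, and for every $\delta>0$ $$\sup\{f(x):x\in S,\ \|x-\xi^\star\|_{\mathcal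 H}\ge\delta\}<f(\xi^\star)\qquad(\sup\emptyset=-\infty).$$ Assume also that $f$ is continuous at $\xi^\star$. Then for every $\epsilon>0$ and $M>0$ there is $N_0\in(0,\infty)$ (depending on $\epsilon,M$ and on the fixed data $\sigma,\Sigma,f,S$) such that for all real $N\ge N_0$ and every $\mu\in K_M$ with $\|\mu-\xi^\star\|_{\mathcal H}\ge\epsilon$, setting $u=(\xi^\star-\mu)/\|\xi^\star-\mu\|_{\mathcal H}$, the directional derivative $D_{\Sigma u}F_N(\mu)=\frac{d}{dt}\big|_{t=0}F_N(\mu+t\Sigma u)$ exists and $$D_{\Sigma u}F_N(\mu)>0 .$$ In particular, for $N\ge N_0$ no $\mu\in K_M$ with $\|\mu-\xi^\star\|_{\mathcal H}\ge\epsilon$ is a stationary point of $F_N$, i.e. it is not the case that $D_hF_N(\mu)=0$ for all $h\in\mathcal H_\Sigma$. -/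

import Mathlib

open MeasureTheory ProbabilityTheory
open scoped RealInnerProductSpace

namespace NatGrad

section SquareRoot

variable {H : Type*} [NormedAddCommGroup H] [InnerProductSpace ℝ H] [CompleteSpace H]

/-- The numbers `C_n / 4 ^ n`, with `C_n` the Catalan numbers. -/
noncomputable def catCoeff (n : ℕ) : ℝ := (catalan n : ℝ) / 4 ^ n

theorem catCoeff_nonneg (n : ℕ) : 0 ≤ catCoeff n := by
  unfold catCoeff; positivity

theorem catCoeff_succ (n : ℕ) :
    catCoeff (n + 1) =
      (1 / 4) * ∑ p ∈ Finset.HasAntidiagonal.antidiagonal n, catCoeff p.1 * catCoeff p.2 := by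
  unfold catCoeff
  rw [catalan_succ', Finset.mul_sum]
  push_cast
  rw [Finset.sum_div]
  refine Finset.sum_congr rfl fun p hp => ?_
  rw [← Finset.HasAntidiagonal.mem_antidiagonal.mp hp, pow_succ, pow_add]
  field_simp

theorem sum_catCoeff_le (n : ℕ) : ∑ i ∈ Finset.range n, catCoeff i ≤ 2 := by
  induction n with
  | zero => simp
  | succ n ih =>
    rw [Finset.sum_range_succ']
    have h0 : catCoeff 0 = 1 := by simp [catCoeff]
    have h1 : ∑ i ∈ Finset.range n, catCoeff (i + 1) ≤
        (1 / 4) * (∑ i ∈ Finset.range n, catCoeff i) ^ 2 := by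
      simp_rw [catCoeff_succ]
      rw [← Finset.mul_sum, sq, Finset.sum_mul_sum, ← Finset.sum_product', Finset.sum_sigma']
      refine mul_le_mul_of_nonneg_left ?_ (by norm_num)
      have hinj : Set.InjOn (fun x : (_ : ℕ) × ℕ × ℕ => x.2)
          (((Finset.range n).sigma fun i => Finset.HasAntidiagonal.antidiagonal i :
            Finset ((_ : ℕ) × ℕ × ℕ)) : Set ((_ : ℕ) × ℕ × ℕ)) := by
        rintro ⟨i, a⟩ hx ⟨j, b⟩ hy hab
        simp only [Finset.coe_sigma, Set.mem_sigma_iff, Finset.mem_coe,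
          Finset.HasAntidiagonal.mem_antidiagonal] at hx hy hab
        subst hab
        have hij : i = j := hx.2.symm.trans hy.2
        subst hij
        rfl
      rw [← Finset.sum_image (f := fun p : ℕ × ℕ => catCoeff p.1 * catCoeff p.2) hinj]
      refine Finset.sum_le_sum_of_subset_of_nonneg ?_ fun p _ _ =>
        mul_nonneg (catCoeff_nonneg _) (catCoeff_nonneg _)
      intro p hp
      simp only [Finset.mem_image, Finset.mem_sigma, Finset.mem_range,
        Finset.HasAntidiagonal.mem_antidiagonal] at hp
      obtain ⟨x, ⟨h1, h2⟩, rfl⟩ := hp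
      simp only [Finset.mem_product, Finset.mem_range]
      omega
    have h2 : 0 ≤ ∑ i ∈ Finset.range n, catCoeff i :=
      Finset.sum_nonneg fun i _ => catCoeff_nonneg i
    nlinarith

theorem summable_catCoeff : Summable catCoeff :=
  summable_of_sum_range_le catCoeff_nonneg sum_catCoeff_le

theorem tsum_catCoeff_le : ∑' n, catCoeff n ≤ 2 :=
  Real.tsum_le_of_sum_range_le catCoeff_nonneg sum_catCoeff_le

section Algebra

variable {𝔸 : Type*} [NormedRing 𝔸] [NormedAlgebra ℝ 𝔸] [CompleteSpace 𝔸] [StarRing 𝔸]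
  [ContinuousStar 𝔸] [StarModule ℝ 𝔸]

theorem exists_catSeries (A : 𝔸) (hA : IsSelfAdjoint A) (hA1 : ‖A‖ ≤ 1) (h1 : ‖(1 : 𝔸)‖ ≤ 1) :
    ∃ X : 𝔸, IsSelfAdjoint X ∧ Commute A X ∧ ‖X‖ ≤ 2 ∧
      X = 1 + (1 / 4 : ℝ) • (A * (X * X)) := by
  have hFle : ∀ n, ‖catCoeff n • A ^ n‖ ≤ catCoeff n := fun n => by
    rw [norm_smul, Real.norm_of_nonneg (catCoeff_nonneg n)]
    refine mul_le_of_le_one_right (catCoeff_nonneg n) ?_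
    rcases Nat.eq_zero_or_pos n with rfl | hn
    · rwa [pow_zero]
    · exact (norm_pow_le' A hn).trans (pow_le_one₀ (norm_nonneg _) hA1)
  have hFn : Summable fun n => ‖catCoeff n • A ^ n‖ :=
    Summable.of_nonneg_of_le (fun _ => norm_nonneg _) hFle summable_catCoeff
  have hFs : Summable fun n => catCoeff n • A ^ n := hFn.of_norm
  refine ⟨∑' n, catCoeff n • A ^ n, ?_, ?_, ?_, ?_⟩
  · rw [IsSelfAdjoint, tsum_star]
    refine tsum_congr fun n => ?_
    rw [star_smul, star_pow, hA.star_eq, star_trivial]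
  · exact Commute.tsum_right _ fun n => ((Commute.refl A).pow_right n).smul_right _
  · exact ((norm_tsum_le_tsum_norm hFn).trans (hFn.tsum_le_tsum hFle summable_catCoeff)).trans
      tsum_catCoeff_le
  · have h2 : Summable fun n => ∑ p ∈ Finset.HasAntidiagonal.antidiagonal n,
        (catCoeff p.1 • A ^ p.1) * (catCoeff p.2 • A ^ p.2) :=
      (summable_norm_sum_mul_antidiagonal_of_summable_norm hFn hFn).of_norm
    have h3 : ∀ n, catCoeff (n + 1) • A ^ (n + 1) =
        (1 / 4 : ℝ) • (A * ∑ p ∈ Finset.HasAntidiagonal.antidiagonal n,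
          (catCoeff p.1 • A ^ p.1) * (catCoeff p.2 • A ^ p.2)) := fun n => by
      have : ∑ p ∈ Finset.HasAntidiagonal.antidiagonal n,
          (catCoeff p.1 • A ^ p.1) * (catCoeff p.2 • A ^ p.2) =
          (∑ p ∈ Finset.HasAntidiagonal.antidiagonal n, catCoeff p.1 * catCoeff p.2) • A ^ n := by
        rw [Finset.sum_smul]
        refine Finset.sum_congr rfl fun p hp => ?_
        rw [smul_mul_smul_comm, ← pow_add, Finset.HasAntidiagonal.mem_antidiagonal.mp hp]
      rw [this, mul_smul_comm, smul_smul, ← catCoeff_succ, ← pow_succ']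
    rw [tsum_mul_tsum_eq_tsum_sum_antidiagonal_of_summable_norm hFn hFn, ← h2.tsum_mul_left A,
      ← (h2.mul_left A).tsum_const_smul (1 / 4 : ℝ), ← tsum_congr h3, hFs.tsum_eq_zero_add]
    simp [catCoeff]

end Algebra

theorem catSeries_sq {𝔸 : Type*} [NormedRing 𝔸] [NormedAlgebra ℝ 𝔸] {A X : 𝔸} (hcomm : Commute A X)
    (hX : X = 1 + (1 / 4 : ℝ) • (A * (X * X))) :
    (1 - (1 / 2 : ℝ) • (A * X)) * (1 - (1 / 2 : ℝ) • (A * X)) = 1 - A := by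
  have h2 : (1 / 4 : ℝ) • (A * (X * X)) = X - 1 := by
    nth_rewrite 3 [hX]; abel
  have h1 : (1 / 4 : ℝ) • (A * X * (A * X)) = A * (X - 1) := by
    rw [← h2, mul_smul_comm, mul_assoc, ← mul_assoc X A X, ← hcomm.eq, mul_assoc A X X]
  have h3 : (1 - (1 / 2 : ℝ) • (A * X)) * (1 - (1 / 2 : ℝ) • (A * X)) =
      1 - A * X + (1 / 4 : ℝ) • (A * X * (A * X)) := by
    simp only [mul_sub, sub_mul, one_mul, mul_one, smul_mul_smul_comm]
    module
  rw [h3, h1, mul_sub, mul_one]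
  abel

theorem norm_one_sub_le {B : H →L[ℝ] H} (hB : B.IsPositive) (hB1 : ‖B‖ ≤ 1) : ‖1 - B‖ ≤ 1 := by
  have hsa : IsSelfAdjoint (1 - B) := (IsSelfAdjoint.one _).sub hB.isSelfAdjoint
  rw [ContinuousLinearMap.norm_eq_iSup_rayleighQuotient (1 - B) hsa.isSymmetric]
  refine Real.iSup_le (fun x => ?_) zero_le_one
  unfold ContinuousLinearMap.rayleighQuotient
  rw [ContinuousLinearMap.reApplyInnerSelf_apply, abs_div, abs_sq]
  refine div_le_one_of_le₀ ?_ (by positivity)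
  have e : ⟪(1 - B) x, x⟫ = ‖x‖ ^ 2 - ⟪B x, x⟫ := by
    simp [inner_sub_left]
  have h1 : 0 ≤ ⟪B x, x⟫ := hB.inner_nonneg_left x
  have h2 : ⟪B x, x⟫ ≤ ‖x‖ ^ 2 := by
    have h3 : ⟪B x, x⟫ ≤ ‖B x‖ * ‖x‖ := real_inner_le_norm _ _
    have h4 : ‖B x‖ ≤ ‖x‖ := B.le_of_opNorm_le_of_le hB1 le_rfl |>.trans_eq (one_mul _)
    nlinarith [norm_nonneg x]
  simp only [RCLike.re_to_real]
  rw [e, abs_le]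
  constructor <;> linarith

theorem isPositive_one_sub {Y : H →L[ℝ] H} (hY : IsSelfAdjoint Y) (hY1 : ‖Y‖ ≤ 1) :
    (1 - Y).IsPositive := by
  rw [ContinuousLinearMap.isPositive_def']
  refine ⟨(IsSelfAdjoint.one _).sub hY, fun x => ?_⟩
  rw [ContinuousLinearMap.reApplyInnerSelf_apply]
  have e : ⟪(1 - Y) x, x⟫ = ‖x‖ ^ 2 - ⟪Y x, x⟫ := by
    simp [inner_sub_left]
  have h3 : ⟪Y x, x⟫ ≤ ‖Y x‖ * ‖x‖ := real_inner_le_norm _ _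
  have h4 : ‖Y x‖ ≤ ‖x‖ := Y.le_of_opNorm_le_of_le hY1 le_rfl |>.trans_eq (one_mul _)
  simp only [RCLike.re_to_real]
  rw [e]
  nlinarith [norm_nonneg x]

theorem exists_posSqrt_of_norm_le_one {B : H →L[ℝ] H} (hB : B.IsPositive) (hB1 : ‖B‖ ≤ 1) :
    ∃ R : H →L[ℝ] H, R.IsPositive ∧ R * R = B := by
  have hsa : IsSelfAdjoint (1 - B) := (IsSelfAdjoint.one _).sub hB.isSelfAdjoint
  have hn : ‖1 - B‖ ≤ 1 := norm_one_sub_le hB hB1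
  obtain ⟨X, hX, hc, hX2, hq⟩ :=
    exists_catSeries (1 - B) hsa hn ContinuousLinearMap.norm_id_le
  refine ⟨_, isPositive_one_sub (Y := (1 / 2 : ℝ) • ((1 - B) * X)) ?_ ?_,
    (catSeries_sq hc hq).trans (sub_sub_cancel 1 B)⟩
  · refine IsSelfAdjoint.smul (IsSelfAdjoint.all (1 / 2 : ℝ)) ?_
    rw [IsSelfAdjoint, star_mul, hX.star_eq, hsa.star_eq]
    exact hc.eq.symm
  · have h1 : ‖(1 - B) * X‖ ≤ 2 :=
      (norm_mul_le (1 - B) X).trans (by nlinarith [norm_nonneg (1 - B), norm_nonneg X])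
    rw [norm_smul]
    norm_num
    linarith

/-- A bounded positive operator on a real Hilbert space has a positive square root. -/
theorem exists_posSqrt (T : H →L[ℝ] H) (hT : T.IsPositive) :
    ∃ R : H →L[ℝ] H, R.IsPositive ∧ R * R = T := by
  have hc0 : 0 < ‖T‖ + 1 := by positivity
  obtain ⟨R, hR, hRR⟩ := exists_posSqrt_of_norm_le_one (B := (‖T‖ + 1)⁻¹ • T)
    (hT.smul_of_nonneg (by positivity)) (by
      rw [norm_smul, norm_inv, Real.norm_of_nonneg hc0.le, inv_mul_le_iff₀ hc0]
      linarith)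
  refine ⟨Real.sqrt (‖T‖ + 1) • R, hR.smul_of_nonneg (Real.sqrt_nonneg _), ?_⟩
  rw [smul_mul_smul_comm, Real.mul_self_sqrt hc0.le, hRR, smul_smul,
    mul_inv_cancel₀ hc0.ne', one_smul]

open Classical in
/-- `T ^ (1/2)`: the (unique) positive square root of a bounded positive operator `T`. -/
noncomputable def sqrtOp (T : H →L[ℝ] H) : H →L[ℝ] H :=
  if h : T.IsPositive then (exists_posSqrt T h).choose else 0

theorem sqrtOp_isPositive {T : H →L[ℝ] H} (hT : T.IsPositive) : (sqrtOp T).IsPositive := by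
  rw [sqrtOp, dif_pos hT]; exact (exists_posSqrt T hT).choose_spec.1

theorem sqrtOp_mul_self {T : H →L[ℝ] H} (hT : T.IsPositive) : sqrtOp T * sqrtOp T = T := by
  rw [sqrtOp, dif_pos hT]; exact (exists_posSqrt T hT).choose_spec.2

end SquareRoot

section Setting

variable {H : Type*} [NormedAddCommGroup H] [InnerProductSpace ℝ H] [CompleteSpace H]

/-- A covariance operator: bounded, self-adjoint, positive, injective and trace-class. For a
positive operator `Q`, being trace-class means that `∑ᵢ ⟪Q eᵢ, eᵢ⟫ < ∞` for some (equivalently,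
every) orthonormal basis `(eᵢ)`. -/
structure IsCovarianceOperator (Q : H →L[ℝ] H) : Prop where
  isPositive : Q.IsPositive
  injective : Function.Injective Q
  traceClass : ∃ (s : Set H) (e : HilbertBasis s ℝ H), Summable fun i : s => ⟪Q (e i), e i⟫

/-- The Cameron-Martin space `Range (Q ^ (1/2))`. -/
noncomputable def cameronMartinSpace (Q : H →L[ℝ] H) : Submodule ℝ H :=
  LinearMap.range (sqrtOp Q : H →ₗ[ℝ] H)

/-- The Cameron-Martin norm `‖Q ^ (-1/2) h‖`, for `h` in the Cameron-Martin space of an injective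
positive operator `Q`; `Q ^ (-1/2)` is the inverse of `Q ^ (1/2)` on its range. -/
noncomputable def cameronMartinNorm (Q : H →L[ℝ] H) (h : H) : ℝ :=
  ‖Function.invFun (sqrtOp Q) h‖

/-- The ellipsoid `K_M`: the closure in `H` of the Cameron-Martin ball of radius `M`. -/
noncomputable def ellipsoid (Q : H →L[ℝ] H) (M : ℝ) : Set H :=
  closure {h : H | h ∈ cameronMartinSpace Q ∧ cameronMartinNorm Q h ≤ M}

/-- `ξ` is the unique optimizer of `f` over `S`, in the well-separated sense: `ξ ∈ S`, every other
point of `S` has a strictly smaller value, and for every `δ > 0` the supremum of `f` over the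
points of `S` at distance at least `δ` from `ξ` is strictly smaller than `f ξ`. -/
structure IsUniqueOptimizer (f : H → ℝ) (S : Set H) (ξ : H) : Prop where
  mem : ξ ∈ S
  lt_of_ne : ∀ x ∈ S, x ≠ ξ → f x < f ξ
  separated : ∀ δ > 0, ∃ c < f ξ, ∀ x ∈ S, δ ≤ ‖x - ξ‖ → f x ≤ c

/-- `g_N = exp (N f) 1_S`; only the values of `f` on `S` matter. -/
noncomputable def expTransform (f : H → ℝ) (S : Set H) (N : ℝ) : H → ℝ :=
  S.indicator fun x => Real.exp (N * f x)

variable [MeasurableSpace H] [BorelSpace H]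

/-- `γ` is the centered Gaussian measure `𝒩(0, C)` on `H`. -/
structure IsCenteredGaussian (γ : Measure H) (C : H →L[ℝ] H) : Prop where
  isGaussian : IsGaussian γ
  mean : ∫ x, x ∂γ = 0
  covariance : ∀ x y : H, covarianceBilin γ x y = ⟪C x, y⟫

/-- The smoothed objective `F_N(μ) = 𝔼[g_N(μ + ε)]`, where `ε` has law `γ`. -/
noncomputable def smoothedObjective (γ : Measure H) (f : H → ℝ) (S : Set H) (N : ℝ) (μ : H) : ℝ :=
  ∫ x, expTransform f S N (μ + x) ∂γ

/-- `μ` is a stationary point of `F`: all directional derivatives of `F` at `μ` along the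
Cameron-Martin space of `Q` exist and vanish. -/
def IsStationary (Q : H →L[ℝ] H) (F : H → ℝ) (μ : H) : Prop :=
  ∀ h ∈ cameronMartinSpace Q, HasLineDerivAt ℝ F 0 μ h

end Setting

end NatGrad

/-! By Cameron–Martin, differentiation falls on the Gaussian density rather than on `g_N`, so
`D_{Σu} F_N(μ) = σ⁻² 𝔼[g_N(μ + ε) ⟪u, ε⟫]` (`hasLineDerivAt_smoothedObjective`). When `μ + ε` lies
near `ξ`, the noise points from `μ` towards `ξ`, so `⟪u, ε⟫` is bounded below by a positive
constant. Away from `ξ`, `g_N ≤ e^{Nc}` with `c < f ξ`, while on a small ball around `ξ` we have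
`g_N ≥ e^{NL}` with `c < L < f ξ`. The expectation is therefore at least `p δ e^{NL} - e^{Nc} 𝔼‖ε‖`,
which is positive for large `N` (`integral_expTransform_mul_inner_ge`).

Uniformity in `μ` rests on `p`, a lower bound for the chance that `μ + ε` hits the small ball
(`exists_le_measureReal_ball`). It comes from `sq_measureReal_le`: the mass lost under a shift is
controlled by the Cameron–Martin norm of the shift alone, and that norm is bounded on the ellipsoid.
-/

namespace NatGrad

/-! ### Gaussian shifts and differentiation under them -/

section CameronMartin

variable {H : Type*} [NormedAddCommGroup H] [InnerProductSpace ℝ H] [CompleteSpace H]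
  [MeasurableSpace H] [BorelSpace H] {γ : Measure H} {C : H →L[ℝ] H}

theorem IsCenteredGaussian.map_inner [SecondCountableTopology H] (hγ : IsCenteredGaussian γ C)
    (v : H) : γ.map (fun x => ⟪v, x⟫) = gaussianReal 0 (⟪C v, v⟫).toNNReal := by
  have := hγ.isGaussian
  have h := IsGaussian.map_eq_gaussianReal (μ := γ) (innerSL ℝ v)
  have h0 : ∫ x, ⟪v, x⟫ ∂γ = 0 := by
    have h := integral_inner (𝕜 := ℝ) (IsGaussian.integrable_id (μ := γ)) v
    simpa [hγ.mean] using h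
  have h1 : Var[fun x => ⟪v, x⟫; γ] = ⟪C v, v⟫ := by
    rw [← covarianceBilin_self IsGaussian.memLp_two_id, hγ.covariance]
  simp only [innerSL_apply_apply] at h
  rw [h0] at h
  rw [← h1]
  exact h

omit [CompleteSpace H] in
theorem IsCenteredGaussian.inner_nonneg [SecondCountableTopology H]
    (hγ : IsCenteredGaussian γ C) (v : H) : 0 ≤ ⟪C v, v⟫ := by
  rw [← hγ.covariance]; exact covarianceBilin_self_nonneg v

omit [CompleteSpace H] in
theorem IsCenteredGaussian.inner_comm (hγ : IsCenteredGaussian γ C) (v w : H) :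
    ⟪C v, w⟫ = ⟪C w, v⟫ := by
  rw [← hγ.covariance, ← hγ.covariance, covarianceBilin_comm]

theorem IsCenteredGaussian.mgf_inner [SecondCountableTopology H] (hγ : IsCenteredGaussian γ C)
    (v : H) (t : ℝ) : mgf (fun x => ⟪v, x⟫) γ t = Real.exp (⟪C v, v⟫ * t ^ 2 / 2) := by
  rw [mgf_gaussianReal (hγ.map_inner v), Real.coe_toNNReal _ (hγ.inner_nonneg v), zero_mul,
    zero_add]

theorem IsCenteredGaussian.integral_exp_inner [SecondCountableTopology H]
    (hγ : IsCenteredGaussian γ C) (v : H) :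
    ∫ x, Real.exp ⟪v, x⟫ ∂γ = Real.exp (⟪C v, v⟫ / 2) := by
  have := hγ.mgf_inner v 1
  simpa [mgf] using this

theorem IsCenteredGaussian.integrable_exp_inner [SecondCountableTopology H]
    (hγ : IsCenteredGaussian γ C) (v : H) : Integrable (fun x => Real.exp ⟪v, x⟫) γ := by
  by_contra h
  have := hγ.integral_exp_inner v
  -- A nonintegrable function has integral `0` by convention, but the value computed above is an
  -- exponential.
  rw [integral_undef h] at this
  exact (Real.exp_pos _).ne this

/-- The Cameron-Martin theorem for shifts in the range of the covariance operator. -/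
theorem IsCenteredGaussian.map_add_eq_tilted [SecondCountableTopology H]
    (hγ : IsCenteredGaussian γ C) (v : H) :
    γ.map (fun x => x + C v) = γ.tilted fun x => ⟪v, x⟫ := by
  have := hγ.isGaussian
  have hP : IsProbabilityMeasure (γ.tilted fun x => ⟪v, x⟫) :=
    isProbabilityMeasure_tilted (hγ.integrable_exp_inner v)
  have hP' : IsProbabilityMeasure (γ.map fun x => x + C v) :=
    Measure.isProbabilityMeasure_map (by fun_prop)
  -- Cramér–Wold: it suffices to match the laws of all `⟪w, x⟫`, which is done through their moment
  -- generating functions.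
  refine Measure.ext_of_charFunDual (funext fun L => ?_)
  obtain ⟨w, rfl⟩ := (InnerProductSpace.toDual ℝ H).surjective L
  have hL : ⇑(InnerProductSpace.toDual ℝ H w) = fun x => ⟪w, x⟫ := by
    ext x; simp
  have hm : mgf (fun x => ⟪w, x⟫) (γ.map fun x => x + C v) =
      mgf (fun x => ⟪w, x⟫) (γ.tilted fun x => ⟪v, x⟫) := by
    funext t
    have e1 : ∀ x, Real.exp (t * ⟪w, x + C v⟫) =
        Real.exp ⟪t • w, x⟫ * Real.exp (t * ⟪w, C v⟫) := fun x => by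
      rw [← Real.exp_add, inner_add_right, inner_smul_left, mul_add]; simp
    have e2 : ∀ x, Real.exp ⟪v, x⟫ / Real.exp (⟪C v, v⟫ / 2) * Real.exp (t * ⟪w, x⟫) =
        Real.exp ⟪v + t • w, x⟫ / Real.exp (⟪C v, v⟫ / 2) := fun x => by
      rw [div_mul_eq_mul_div, ← Real.exp_add, inner_add_left, inner_smul_left]; simp
    simp only [mgf]
    rw [integral_map (by fun_prop) (by fun_prop), integral_tilted]
    simp only [hγ.integral_exp_inner, smul_eq_mul, e1, e2]
    rw [integral_mul_const, integral_div, hγ.integral_exp_inner, hγ.integral_exp_inner,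
      ← Real.exp_add, ← Real.exp_sub]
    congr 1
    simp only [map_add, map_smul, inner_add_left, inner_add_right, inner_smul_left,
      inner_smul_right, hγ.inner_comm w v, real_inner_comm (C v) w]
    simp
    ring
  -- All exponential moments are finite, so the analytic continuation of the mgf is determined on
  -- all of `ℂ`.
  have hI : integrableExpSet (fun x => ⟪w, x⟫) (γ.map fun x => x + C v) = Set.univ := by
    refine Set.eq_univ_of_forall fun t => ?_
    rw [integrableExpSet, Set.mem_ofPred_eq, integrable_map_measure (by fun_prop) (by fun_prop)]
    have := (hγ.integrable_exp_inner (t • w)).mul_const (Real.exp (t * ⟪w, C v⟫))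
    refine this.congr (ae_of_all _ fun x => ?_)
    simp [← Real.exp_add, inner_add_right, inner_smul_left, mul_add]
  have hc : complexMGF (fun x => ⟪w, x⟫) (γ.map fun x => x + C v) =
      complexMGF (fun x => ⟪w, x⟫) (γ.tilted fun x => ⟪v, x⟫) := by
    funext z
    exact eqOn_complexMGF_of_mgf hm (by simp [hI])
  have hmap := Measure.ext_of_complexMGF_eq (by fun_prop) (by fun_prop) hc
  rw [charFunDual_eq_charFun_map_one, charFunDual_eq_charFun_map_one, hL, hmap]

theorem IsCenteredGaussian.integral_comp_add [SecondCountableTopology H]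
    (hγ : IsCenteredGaussian γ C) (v : H) {g : H → ℝ} (hg : Measurable g) :
    ∫ x, g (x + C v) ∂γ = Real.exp (-(⟪C v, v⟫ / 2)) * ∫ x, Real.exp ⟪v, x⟫ * g x ∂γ := by
  rw [← integral_map (φ := fun x => x + C v) (f := g) (by fun_prop) hg.aestronglyMeasurable,
    hγ.map_add_eq_tilted, integral_tilted, hγ.integral_exp_inner, ← integral_const_mul]
  refine integral_congr_ae (ae_of_all _ fun x => ?_)
  simp only [smul_eq_mul, Real.exp_neg]
  ring

/-- Cauchy–Schwarz on `B` for `e^{⟪v, x⟫}` and `e^{-⟪v, x⟫}`: the first integral is the shifted mass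
up to a factor, and the second is at most `e^{k/2}`. -/
theorem IsCenteredGaussian.sq_measureReal_le [SecondCountableTopology H]
    (hγ : IsCenteredGaussian γ C) (v : H) {B : Set H} (hB : MeasurableSet B) :
    Real.exp (-⟪C v, v⟫) * γ.real B ^ 2 ≤ γ.real ((fun x => x + C v) ⁻¹' B) := by
  have := hγ.isGaussian
  set k := ⟪C v, v⟫ with hk
  have hkn : ⟪C (-v), -v⟫ = k := by simp [hk]
  have hBv : MeasurableSet ((fun x => x + C v) ⁻¹' B) := hB.preimage (by fun_prop)
  have h1 : γ.real ((fun x => x + C v) ⁻¹' B) =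
      Real.exp (-(k / 2)) * ∫ x in B, Real.exp ⟪v, x⟫ ∂γ := by
    have h := hγ.integral_comp_add v (g := B.indicator 1) (measurable_one.indicator hB)
    have e : (fun x => B.indicator (1 : H → ℝ) (x + C v)) =
        ((fun x => x + C v) ⁻¹' B).indicator 1 := by
      ext x; simp only [Set.indicator, Set.mem_preimage]; rfl
    rw [e, integral_indicator_one hBv] at h
    rw [h, ← integral_indicator hB]
    congr 2
    ext x
    by_cases hx : x ∈ B <;> simp [hx]
  set s := γ.real B * Real.exp (-(k / 2)) with hs
  have hi1 : Integrable (fun x => Real.exp ⟪v, x⟫) γ := hγ.integrable_exp_inner v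
  have hi2 : Integrable (fun x => Real.exp ⟪-v, x⟫) γ := hγ.integrable_exp_inner (-v)
  -- Cauchy–Schwarz in linearized form, `E ≥ 2s - s² E⁻¹`; the chosen `s` maximizes `2 s γ(B) - s²
  -- e^{k/2}`.
  have h2 : ∫ x in B, (2 * s - s ^ 2 * Real.exp ⟪-v, x⟫) ∂γ ≤ ∫ x in B, Real.exp ⟪v, x⟫ ∂γ := by
    refine integral_mono ((integrable_const _).sub (hi2.const_mul _).integrableOn)
      hi1.integrableOn fun x => ?_
    have h : Real.exp ⟪v, x⟫ * Real.exp ⟪-v, x⟫ = 1 := by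
      rw [← Real.exp_add]; simp
    have h' := Real.exp_pos ⟪-v, x⟫
    have : Real.exp ⟪v, x⟫ - (2 * s - s ^ 2 * Real.exp ⟪-v, x⟫) =
        Real.exp ⟪-v, x⟫ * (Real.exp ⟪v, x⟫ - s) ^ 2 := by
      linear_combination (2 * s - Real.exp ⟪v, x⟫) * h
    have h3 : 0 ≤ Real.exp ⟪-v, x⟫ * (Real.exp ⟪v, x⟫ - s) ^ 2 := by positivity
    linarith
  have h3 : ∫ x in B, Real.exp ⟪-v, x⟫ ∂γ ≤ Real.exp (k / 2) := by
    rw [← hkn, ← hγ.integral_exp_inner]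
    exact setIntegral_le_integral hi2 (ae_of_all _ fun x => (Real.exp_pos _).le)
  rw [integral_sub (integrable_const _) (hi2.const_mul _).integrableOn,
    integral_const_mul (s ^ 2) (fun x => Real.exp ⟪-v, x⟫), setIntegral_const, smul_eq_mul] at h2
  have h4 : Real.exp (-(k / 2)) * Real.exp (k / 2) = 1 := by rw [← Real.exp_add]; simp
  have h5 : Real.exp (-k) = Real.exp (-(k / 2)) * Real.exp (-(k / 2)) := by
    rw [← Real.exp_add]; ring_nf
  rw [h1, h5, mul_assoc]
  refine mul_le_mul_of_nonneg_left (le_trans ?_ h2) (Real.exp_pos _).le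
  have h6 := mul_le_mul_of_nonneg_left h3 (sq_nonneg s)
  have h7 : s ^ 2 * Real.exp (k / 2) = γ.real B ^ 2 * Real.exp (-(k / 2)) := by
    rw [hs]
    linear_combination (γ.real B ^ 2 * Real.exp (-(k / 2))) * h4
  have h8 : γ.real B * (2 * s) = 2 * (γ.real B ^ 2 * Real.exp (-(k / 2))) := by
    rw [hs]; ring
  linarith

/-- No regularity of `g` is needed: by the shift formula the integral is a Gaussian factor times the
mgf of `⟪v, x⟫` under `g · γ`, and mgfs are smooth. -/
theorem IsCenteredGaussian.hasDerivAt_integral_comp_add [SecondCountableTopology H]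
    (hγ : IsCenteredGaussian γ C) (v : H) {g : H → ℝ} (hg : Measurable g) (hg0 : ∀ x, 0 ≤ g x)
    {b : ℝ} (hgb : ∀ x, g x ≤ b) :
    HasDerivAt (fun t : ℝ => ∫ x, g (x + t • C v) ∂γ) (∫ x, g x * ⟪v, x⟫ ∂γ) 0 := by
  have hG : Measurable fun x => (g x).toNNReal := hg.real_toNNReal
  set ν := γ.withDensity fun x => ((g x).toNNReal : ENNReal) with hν
  have hint : integrableExpSet (fun x => ⟪v, x⟫) ν = Set.univ := by
    refine Set.eq_univ_of_forall fun t => ?_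
    rw [integrableExpSet, Set.mem_ofPred_eq, hν, integrable_withDensity_iff_integrable_smul hG]
    have h := (hγ.integrable_exp_inner (t • v)).bdd_mul (c := b) hg.aestronglyMeasurable
      (ae_of_all _ fun x => by rw [Real.norm_of_nonneg (hg0 x)]; exact hgb x)
    refine h.congr (ae_of_all _ fun x => ?_)
    simp [NNReal.smul_def, hg0 x, inner_smul_left]
  have hd := hasDerivAt_mgf (X := fun x => ⟪v, x⟫) (μ := ν) (t := 0) (by simp [hint])
  -- The Gaussian factor has value `1` and derivative `0` at `t = 0`, so only the mgf contributes.
  have he : HasDerivAt (fun t : ℝ => Real.exp (-(⟪C v, v⟫ * t ^ 2 / 2))) 0 0 := by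
    have := ((((hasDerivAt_id (0 : ℝ)).pow 2).const_mul ⟪C v, v⟫).div_const 2).neg.exp
    simpa using this
  have h := he.mul hd
  have e1 : (fun t : ℝ => ∫ x, g (x + t • C v) ∂γ) =
      (fun t : ℝ => Real.exp (-(⟪C v, v⟫ * t ^ 2 / 2))) * mgf (fun x => ⟪v, x⟫) ν := by
    funext t
    have := hγ.integral_comp_add (t • v) hg
    rw [map_smul] at this
    rw [this, Pi.mul_apply, mgf, hν, integral_withDensity_eq_integral_smul hG]
    congr 1
    · simp only [inner_smul_left, inner_smul_right]
      simp
      ring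
    · refine integral_congr_ae (ae_of_all _ fun x => ?_)
      simp [NNReal.smul_def, hg0 x, inner_smul_left, mul_comm]
  rw [e1]
  refine h.congr_deriv ?_
  rw [hν, integral_withDensity_eq_integral_smul hG]
  simp [NNReal.smul_def, hg0]

end CameronMartin

/-! ### Uniform small-ball bounds over the ellipsoid -/

section Ellipsoid

variable {H : Type*} [NormedAddCommGroup H] [InnerProductSpace ℝ H] [CompleteSpace H]

theorem sqrtOp_sqrtOp_apply {Q : H →L[ℝ] H} (hQ : Q.IsPositive) (v : H) :
    sqrtOp Q (sqrtOp Q v) = Q v := by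
  conv_rhs => rw [← sqrtOp_mul_self hQ]
  rfl

theorem inner_apply_self_eq_norm_sqrtOp {Q : H →L[ℝ] H} (hQ : Q.IsPositive) (v : H) :
    ⟪Q v, v⟫ = ‖sqrtOp Q v‖ ^ 2 := by
  rw [← sqrtOp_sqrtOp_apply hQ, ← real_inner_self_eq_norm_sq]
  exact (sqrtOp_isPositive hQ).isSymmetric _ _

theorem IsCovarianceOperator.injective_sqrtOp {Q : H →L[ℝ] H} (hQ : IsCovarianceOperator Q) :
    Function.Injective (sqrtOp Q) := fun x y h => hQ.injective <| by
  rw [← sqrtOp_sqrtOp_apply hQ.isPositive, h, sqrtOp_sqrtOp_apply hQ.isPositive]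

/-- An injective positive operator has dense range. -/
theorem denseRange_of_isPositive {T : H →L[ℝ] H} (hT : T.IsPositive)
    (hinj : Function.Injective T) : DenseRange T := by
  have h : T.range.topologicalClosure = ⊤ := by
    rw [Submodule.topologicalClosure_eq_top_iff, ContinuousLinearMap.orthogonal_range,
      hT.isSelfAdjoint.adjoint_eq]
    exact LinearMap.ker_eq_bot.2 hinj
  exact Submodule.dense_iff_topologicalClosure_eq_top.2 h

theorem IsCovarianceOperator.exists_norm_sub_lt {Q : H →L[ℝ] H} (hQ : IsCovarianceOperator Q)
    (x : H) {r : ℝ} (hr : 0 < r) : ∃ v, ‖Q v - x‖ < r := by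
  obtain ⟨v, hv⟩ := (denseRange_of_isPositive hQ.isPositive hQ.injective).exists_dist_lt x hr
  exact ⟨v, by rwa [dist_comm, dist_eq_norm] at hv⟩

/-- The shift formula covers only the range of the covariance, so points of the closed ellipsoid are
replaced by nearby `Q v`; density costs at most `1` in Cameron–Martin norm. -/
theorem IsCovarianceOperator.exists_norm_sub_lt_of_mem_ellipsoid {Q : H →L[ℝ] H}
    (hQ : IsCovarianceOperator Q) {M : ℝ} {μ : H} (hμ : μ ∈ ellipsoid Q M) {r : ℝ} (hr : 0 < r) :
    ∃ v, ‖Q v - μ‖ < r ∧ ‖sqrtOp Q v‖ ≤ M + 1 := by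
  obtain ⟨h, ⟨hh, hn⟩, hd⟩ := Metric.mem_closure_iff.1 hμ (r / 2) (half_pos hr)
  set a := Function.invFun (sqrtOp Q) h with ha
  have hah : sqrtOp Q a = h := Function.invFun_eq hh
  have hc : 0 < ‖sqrtOp Q‖ + 1 := by positivity
  have hs : 0 < min 1 (r / 2 / (‖sqrtOp Q‖ + 1)) := by positivity
  obtain ⟨v, hv⟩ := (denseRange_of_isPositive (sqrtOp_isPositive hQ.isPositive)
    hQ.injective_sqrtOp).exists_dist_lt a hs
  rw [dist_comm, dist_eq_norm, lt_min_iff, lt_div_iff₀ hc] at hv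
  rw [dist_comm, dist_eq_norm] at hd
  refine ⟨v, ?_, ?_⟩
  · have e : Q v - μ = sqrtOp Q (sqrtOp Q v - a) + (h - μ) := by
      rw [map_sub, sqrtOp_sqrtOp_apply hQ.isPositive, hah]; abel
    have h1 := (sqrtOp Q).le_opNorm (sqrtOp Q v - a)
    have h2 := norm_add_le (sqrtOp Q (sqrtOp Q v - a)) (h - μ)
    rw [e]
    nlinarith [norm_nonneg (sqrtOp Q v - a)]
  · have h1 := norm_le_norm_add_norm_sub' (sqrtOp Q v) a
    have h2 : ‖a‖ ≤ M := hn
    linarith [hv.1]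

variable [TopologicalSpace.SeparableSpace H] [MeasurableSpace H] [BorelSpace H] {γ : Measure H}

/-- The Gaussian measures with means in an ellipsoid charge a fixed ball uniformly. -/
theorem IsCovarianceOperator.exists_le_measureReal_ball {Q : H →L[ℝ] H}
    (hQ : IsCovarianceOperator Q) {σ : ℝ} (hσ : 0 < σ) (hγ : IsCenteredGaussian γ (σ ^ 2 • Q))
    (M : ℝ) (ξ : H) {η : ℝ} (hη : 0 < η) :
    ∃ p > 0, ∀ μ ∈ ellipsoid Q M, p ≤ γ.real {x | ‖μ + x - ξ‖ < η} := by
  have := hγ.isGaussian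
  have : SecondCountableTopology H := UniformSpace.secondCountable_of_separable H
  have hη4 : 0 < η / 4 := by positivity
  -- By separability some ball of radius `η / 4` is charged; its location does not matter, since it
  -- will be shifted.
  obtain ⟨y, hy⟩ : ∃ y, γ (Metric.ball y (η / 4)) ≠ 0 := by
    by_contra! h
    have h0 : γ Set.univ = 0 := by
      refine measure_null_of_locally_null _ fun x _ => ?_
      exact ⟨_, mem_nhdsWithin_of_mem_nhds (Metric.ball_mem_nhds x hη4), h x⟩
    simp at h0
  have hp : 0 < γ.real (Metric.ball y (η / 4)) :=
    ENNReal.toReal_pos hy (measure_ne_top _ _)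
  obtain ⟨a, ha⟩ := hQ.exists_norm_sub_lt y hη4
  obtain ⟨b, hb⟩ := hQ.exists_norm_sub_lt ξ hη4
  refine ⟨Real.exp (-((σ ^ 2)⁻¹ * (‖sqrtOp Q (a - b)‖ + (M + 1)) ^ 2)) *
    γ.real (Metric.ball y (η / 4)) ^ 2, by positivity, fun μ hμ => ?_⟩
  obtain ⟨c, hc, hcM⟩ := hQ.exists_norm_sub_lt_of_mem_ellipsoid hμ hη4
  -- With `Q a ≈ y`, `Q b ≈ ξ`, `Q c ≈ μ`, the shift `Q (a - b + c)` is close to `y - ξ + μ`. Only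
  -- `c` depends on `μ`, and its Cameron–Martin norm is at most `M + 1`.
  set w := (σ ^ 2)⁻¹ • (a - b + c) with hw
  have hCw : (σ ^ 2 • Q) w = Q (a - b + c) := by
    rw [hw, map_smul, smul_apply, smul_smul, inv_mul_cancel₀ (by positivity),
      one_smul]
  refine le_trans ?_ ((hγ.sq_measureReal_le w (measurableSet_ball (x := y) (ε := η / 4))).trans
    (measureReal_mono ?_))
  · gcongr
    rw [hCw, hw, inner_smul_right, inner_apply_self_eq_norm_sqrtOp hQ.isPositive]
    gcongr
    rw [map_add]
    exact (norm_add_le _ _).trans (by gcongr)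
  · intro x hx
    rw [Set.mem_preimage, hCw, mem_ball_iff_norm] at hx
    have e : μ + x - ξ = (x + Q (a - b + c) - y) - (Q a - y) + (Q b - ξ) - (Q c - μ) := by
      simp only [map_add, map_sub]; abel
    rw [Set.mem_ofPred_eq, e]
    have h1 := norm_sub_le (x + Q (a - b + c) - y - (Q a - y) + (Q b - ξ)) (Q c - μ)
    have h2 := norm_add_le (x + Q (a - b + c) - y - (Q a - y)) (Q b - ξ)
    have h3 := norm_sub_le (x + Q (a - b + c) - y) (Q a - y)
    linarith

end Ellipsoid

/-! ### The derivative of the smoothed objective and its lower bound -/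

section Objective

variable {H : Type*} [NormedAddCommGroup H] {S : Set H} {f : H → ℝ}

omit [NormedAddCommGroup H] in
theorem expTransform_nonneg (f : H → ℝ) (S : Set H) (N : ℝ) (x : H) : 0 ≤ expTransform f S N x :=
  Set.indicator_nonneg (fun _ _ => (Real.exp_pos _).le) x

omit [NormedAddCommGroup H] in
theorem measurable_expTransform [MeasurableSpace H] (hS : MeasurableSet S)
    (hf : Measurable fun x : S => f x) (N : ℝ) : Measurable (expTransform f S N) := by
  refine measurable_of_restrict_of_restrict_compl hS ?_ ?_
  · have h : S.domRestrict (expTransform f S N) = fun x : S => Real.exp (N * f x) := by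
      ext x
      rw [Set.domRestrict_apply, expTransform, Set.indicator_of_mem x.2]
    rw [h]
    exact (hf.const_mul N).exp
  · have h : Sᶜ.domRestrict (expTransform f S N) = fun _ => 0 := by
      ext x
      rw [Set.domRestrict_apply, expTransform, Set.indicator_of_notMem x.2]
    rw [h]
    exact measurable_const

variable [InnerProductSpace ℝ H]

/-- The weight `g_N` times the component of `x - μ` towards the optimizer is bounded below by the
contribution of a small ball around the optimizer, up to an exponentially smaller error. -/
theorem le_expTransform_mul_inner {ξ : H} {c L δ η N : ℝ} (hN : 0 ≤ N)
    (hc : ∀ x ∈ S, δ ≤ ‖x - ξ‖ → f x ≤ c) (hηδ : η ≤ δ)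
    (hη : ∀ x, ‖x - ξ‖ < η → x ∈ S ∧ L ≤ f x) {μ : H} (hμ : 2 * δ ≤ ‖ξ - μ‖) (hδ : 0 < δ) (x : H) :
    {x | ‖μ + x - ξ‖ < η}.indicator (fun _ => δ * Real.exp (N * L)) x - Real.exp (N * c) * ‖x‖ ≤
      expTransform f S N (μ + x) * ⟪‖ξ - μ‖⁻¹ • (ξ - μ), x⟫ := by
  have hpos : 0 < ‖ξ - μ‖ := by linarith
  set u := ‖ξ - μ‖⁻¹ • (ξ - μ) with hu
  have hu1 : ‖u‖ = 1 := by
    rw [hu, norm_smul, norm_inv, norm_norm, inv_mul_cancel₀ hpos.ne']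
  have huξ : ⟪u, ξ - μ⟫ = ‖ξ - μ‖ := by
    rw [hu, real_inner_smul_left, real_inner_self_eq_norm_sq]; field_simp
  have hg := expTransform_nonneg f S N (μ + x)
  have hin : ‖ξ - μ‖ - ‖μ + x - ξ‖ ≤ ⟪u, x⟫ := by
    have e : x = (ξ - μ) + (μ + x - ξ) := by abel
    have h := abs_real_inner_le_norm u (μ + x - ξ)
    rw [hu1, one_mul] at h
    have h' : ⟪u, x⟫ = ‖ξ - μ‖ + ⟪u, μ + x - ξ⟫ := by
      rw [← huξ, ← inner_add_right, ← e]
    linarith [neg_abs_le ⟪u, μ + x - ξ⟫]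
  have hE : 0 ≤ Real.exp (N * c) * ‖x‖ := by positivity
  by_cases h1 : ‖μ + x - ξ‖ < η
  · have hx : x ∈ {x | ‖μ + x - ξ‖ < η} := h1
    rw [Set.indicator_of_mem hx]
    obtain ⟨hxS, hxL⟩ := hη _ h1
    have h2 : Real.exp (N * L) ≤ expTransform f S N (μ + x) := by
      rw [expTransform, Set.indicator_of_mem hxS]
      gcongr
    have h3 : δ ≤ ⟪u, x⟫ := by linarith
    have := mul_le_mul h2 h3 hδ.le hg
    linarith
  · have hx : x ∉ {x | ‖μ + x - ξ‖ < η} := h1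
    rw [Set.indicator_of_notMem hx]
    -- Between the radii `η` and `δ` there is no lower bound on the weight, but the inner product is
    -- still nonnegative, so this region does no harm.
    by_cases h2 : ‖μ + x - ξ‖ < δ
    · have : 0 ≤ expTransform f S N (μ + x) * ⟪u, x⟫ := mul_nonneg hg (by linarith)
      linarith
    · have h3 : expTransform f S N (μ + x) ≤ Real.exp (N * c) := by
        by_cases hxS : μ + x ∈ S
        · rw [expTransform, Set.indicator_of_mem hxS]
          gcongr
          exact hc _ hxS (not_lt.1 h2)
        · rw [expTransform, Set.indicator_of_notMem hxS]
          positivity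
      have h4 := abs_real_inner_le_norm u x
      rw [hu1, one_mul] at h4
      have h5 := mul_le_mul h3 h4 (abs_nonneg _) (Real.exp_pos _).le
      have h6 := mul_le_mul_of_nonneg_left (neg_abs_le ⟪u, x⟫) hg
      linarith

variable [CompleteSpace H] [TopologicalSpace.SeparableSpace H] [MeasurableSpace H] [BorelSpace H]
  {γ : Measure H}

theorem hasLineDerivAt_smoothedObjective {Q : H →L[ℝ] H} {σ : ℝ} (hσ : 0 < σ)
    (hγ : IsCenteredGaussian γ (σ ^ 2 • Q)) (hS : MeasurableSet S)
    (hf : Measurable fun x : S => f x) {N B : ℝ} (hB : ∀ x, expTransform f S N x ≤ B) (μ u : H) :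
    HasLineDerivAt ℝ (smoothedObjective γ f S N)
      ((σ ^ 2)⁻¹ * ∫ x, expTransform f S N (μ + x) * ⟪u, x⟫ ∂γ) μ (Q u) := by
  have : SecondCountableTopology H := UniformSpace.secondCountable_of_separable H
  have hd := hγ.hasDerivAt_integral_comp_add ((σ ^ 2)⁻¹ • u)
    (g := fun x => expTransform f S N (μ + x))
    ((measurable_expTransform hS hf N).comp (measurable_const_add μ))
    (fun x => expTransform_nonneg f S N _) (fun x => hB _)
  -- The direction `Q u` is the covariance `σ² Q` applied to `σ⁻² u`, hence the factor `σ⁻²`.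
  have hCu : (σ ^ 2 • Q) ((σ ^ 2)⁻¹ • u) = Q u := by
    rw [map_smul, smul_apply, smul_smul, inv_mul_cancel₀ (by positivity),
      one_smul]
  rw [hCu] at hd
  have e1 : (fun t : ℝ => ∫ x, expTransform f S N (μ + (x + t • Q u)) ∂γ) =
      fun t : ℝ => smoothedObjective γ f S N (μ + t • Q u) := by
    funext t
    simp only [smoothedObjective, add_comm, add_left_comm]
  rw [e1] at hd
  refine HasDerivAt.congr_deriv hd ?_
  rw [← integral_const_mul]
  simp only [real_inner_smul_left]
  exact integral_congr_ae (ae_of_all _ fun x => by ring)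

theorem integral_expTransform_mul_inner_ge {Q : H →L[ℝ] H} (hγ : IsCenteredGaussian γ Q)
    (hS : MeasurableSet S) (hf : Measurable fun x : S => f x) {ξ : H} {c L δ η N B : ℝ}
    (hN : 0 ≤ N) (hB : ∀ x, expTransform f S N x ≤ B)
    (hc : ∀ x ∈ S, δ ≤ ‖x - ξ‖ → f x ≤ c) (hηδ : η ≤ δ)
    (hη : ∀ x, ‖x - ξ‖ < η → x ∈ S ∧ L ≤ f x) {μ : H} (hμ : 2 * δ ≤ ‖ξ - μ‖) (hδ : 0 < δ) :
    γ.real {x | ‖μ + x - ξ‖ < η} * (δ * Real.exp (N * L)) - Real.exp (N * c) * ∫ x, ‖x‖ ∂γ ≤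
      ∫ x, expTransform f S N (μ + x) * ⟪‖ξ - μ‖⁻¹ • (ξ - μ), x⟫ ∂γ := by
  have := hγ.isGaussian
  have : SecondCountableTopology H := UniformSpace.secondCountable_of_separable H
  have hid : Integrable (fun x : H => x) γ := IsGaussian.integrable_id
  have hBm : MeasurableSet {x | ‖μ + x - ξ‖ < η} :=
    measurableSet_lt (by fun_prop) measurable_const
  have hg : Measurable fun x => expTransform f S N (μ + x) :=
    (measurable_expTransform hS hf N).comp (measurable_const_add μ)
  have hi : Integrable ({x | ‖μ + x - ξ‖ < η}.indicator fun _ => δ * Real.exp (N * L)) γ :=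
    (integrable_const _).indicator hBm
  rw [← smul_eq_mul (γ.real _), ← integral_indicator_const _ hBm, ← integral_const_mul,
    ← integral_sub hi (hid.norm.const_mul _)]
  refine integral_mono (hi.sub (hid.norm.const_mul _)) ?_
    (le_expTransform_mul_inner hN hc hηδ hη hμ hδ)
  exact (hid.const_inner _).bdd_mul (c := B) hg.aestronglyMeasurable (ae_of_all _ fun x => by
    rw [Real.norm_of_nonneg (expTransform_nonneg f S N _)]; exact hB _)

end Objective

end NatGrad

/-! ### The main theorem -/

open NatGrad in
theorem theorem1 {H : Type*} [NormedAddCommGroup H] [InnerProductSpace ℝ H] [CompleteSpace H]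
    [TopologicalSpace.SeparableSpace H] [MeasurableSpace H] [BorelSpace H]
    (Q : H →L[ℝ] H) (hQ : IsCovarianceOperator Q) (σ : ℝ) (hσ : 0 < σ)
    (γ : Measure H) (hγ : IsCenteredGaussian γ (σ ^ 2 • Q))
    (S : Set H) (hS : MeasurableSet S) (f : H → ℝ) (hf : Measurable fun x : S => f x)
    (hbdd : ∀ N : ℝ, 0 < N → ∃ B : ℝ, ∀ x, expTransform f S N x ≤ B)
    (ξ : H) (hξ : IsUniqueOptimizer f S ξ) (hint : ξ ∈ interior S) (hcont : ContinuousAt f ξ)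
    (ε M : ℝ) (hε : 0 < ε) (hM : 0 < M) :
    ∃ N₀ : ℝ, 0 < N₀ ∧ ∀ N : ℝ, N₀ ≤ N → ∀ μ ∈ ellipsoid Q M, ε ≤ ‖μ - ξ‖ →
      (LineDifferentiableAt ℝ (smoothedObjective γ f S N) μ (Q (‖ξ - μ‖⁻¹ • (ξ - μ))) ∧
        0 < lineDeriv ℝ (smoothedObjective γ f S N) μ (Q (‖ξ - μ‖⁻¹ • (ξ - μ)))) ∧
      ¬ IsStationary Q (smoothedObjective γ f S N) μ := by
  -- Half of `ε`, so that `‖ξ - μ‖ ≥ 2δ` leaves a margin `δ` within distance `δ` of `ξ`.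
  set δ := ε / 2 with hδdef
  have hδ : 0 < δ := half_pos hε
  obtain ⟨c, hcf, hc⟩ := hξ.separated δ hδ
  obtain ⟨L, hcL, hLf⟩ := exists_between hcf
  obtain ⟨η', hη', hball⟩ := Metric.eventually_nhds_iff.1
    ((Filter.eventually_mem_set.2 (mem_interior_iff_mem_nhds.1 hint)).and
      (hcont.eventually (lt_mem_nhds hLf)))
  have hη : 0 < min η' δ := lt_min hη' hδ
  have hSL : ∀ x, ‖x - ξ‖ < min η' δ → x ∈ S ∧ L ≤ f x := fun x hx => by
    obtain ⟨h1, h2⟩ := hball (y := x) (by rw [dist_eq_norm]; exact hx.trans_le (min_le_left _ _))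
    exact ⟨h1, h2.le⟩
  obtain ⟨p, hp, hpμ⟩ := hQ.exists_le_measureReal_ball hσ hγ M ξ hη
  set m := ∫ x, ‖x‖ ∂γ with hm
  -- From `e^t ≥ 1 + t`, this threshold gives `p δ e^{N(L - c)} > m`; the `1` keeps it positive.
  refine ⟨max 1 (m / (p * δ * (L - c))), by positivity, fun N hN μ hμ hεμ => ?_⟩
  have hN0 : 0 < N := one_pos.trans_le ((le_max_left _ _).trans hN)
  have hLc : 0 < L - c := sub_pos.2 hcL
  obtain ⟨B, hB⟩ := hbdd N hN0
  have hδμ : 2 * δ ≤ ‖ξ - μ‖ := by rw [norm_sub_rev]; linarith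
  have hD := hasLineDerivAt_smoothedObjective hσ hγ hS hf hB μ (‖ξ - μ‖⁻¹ • (ξ - μ))
  have hI := integral_expTransform_mul_inner_ge hγ hS hf hN0.le hB hc (min_le_right _ _) hSL hδμ hδ
  have hpos : m < p * δ * Real.exp (N * (L - c)) := by
    have h1 : m / (p * δ * (L - c)) ≤ N := (le_max_right _ _).trans hN
    rw [div_le_iff₀ (by positivity)] at h1
    have h2 := Real.add_one_le_exp (N * (L - c))
    have h3 : 0 < p * δ := by positivity
    nlinarith
  have hexp : Real.exp (N * L) = Real.exp (N * c) * Real.exp (N * (L - c)) := by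
    rw [← Real.exp_add]; ring_nf
  have hI0 : 0 < ∫ x, expTransform f S N (μ + x) * ⟪‖ξ - μ‖⁻¹ • (ξ - μ), x⟫ ∂γ := by
    refine lt_of_lt_of_le ?_ hI
    have h1 : p * (δ * Real.exp (N * L)) ≤
        γ.real {x | ‖μ + x - ξ‖ < min η' δ} * (δ * Real.exp (N * L)) := by
      gcongr
      exact hpμ μ hμ
    have h2 := mul_lt_mul_of_pos_left hpos (Real.exp_pos (N * c))
    have h3 : p * (δ * Real.exp (N * L)) =
        Real.exp (N * c) * (p * δ * Real.exp (N * (L - c))) := by rw [hexp]; ring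
    linarith
  have hlt : 0 < lineDeriv ℝ (smoothedObjective γ f S N) μ (Q (‖ξ - μ‖⁻¹ • (ξ - μ))) := by
    rw [hD.lineDeriv]; positivity
  refine ⟨⟨hD.lineDifferentiableAt, hlt⟩, fun hst => hlt.ne' (hst _ ?_).lineDeriv⟩
  -- `Q u = Q^{1/2} (Q^{1/2} u)` is a Cameron–Martin direction.
  exact ⟨_, sqrtOp_sqrtOp_apply hQ.isPositive _⟩
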